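/- Let $(m_n)_{n\ge1}$ be a sequence of integers with $m_n\ge1$, and let $(X_{ni})_{n\ge1,\,1\le i\le N_n}$ be a triangular array of real random variables (the variables in each row are defined on a common probability space, which may depend on $n$). Suppose that every row is $m_n$-dependent: for every $n$ and every $k$, the two families $(X_{ni})_{1\le i\le k}$ and $(X_{ni})_{k+m_n<i\le N_n}$ are independent of each other. Suppose further that the variables $X_{ni}$ have finite second moments and $\mathbb E X_{ni}=0$. Let $S_n:=\sum_{i=1}^{N_n}X_{ni}$ and $\sigma_n^2:=\operatorname{Var}S_n$ with $\sigma_n\ge 0$, and assume that $\sigma_n^2>0$ for all large $n$. Finally, assume that for every $\varepsilon>0$, $$\frac{m_n}{\sigma_n^2}\sum_{i=1}^{N_n}\mathbb E\Bigl[X_{ni}^2\,\mathbf 1\bigl\{|X_{ni}|>\varepsilon\sigma_n/m_n\bigr\}\Bigr]\to0\qquad\text{as }n\to\infty.$$ Then $S_n/\sigma_n$ converges in distribution to the standard normal distribution $N(0,1)$ as $n\to\infty$. -/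

import Mathlib

open MeasureTheory ProbabilityTheory Filter Topology

/-- A (finite or infinite) sequence `(X i)` of real random variables, with `i` running over the
index set `s` of natural numbers, is `m`-dependent if for every `k` the two families
`(X i)` for `i ≤ k` and `(X i)` for `i > k + m` are independent of each other. -/
def IsMDependent {Ω : Type*} [MeasurableSpace Ω] (m : ℕ) (s : Set ℕ) (X : ℕ → Ω → ℝ)
    (μ : Measure Ω) : Prop :=
  ∀ k : ℕ, IndepFun (fun ω (i : {i : ℕ // i ∈ s ∧ i ≤ k}) => X i ω)
    (fun ω (i : {i : ℕ // i ∈ s ∧ k + m < i}) => X i ω) μ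

/-- The sum of a row `X 1, ..., X N`. -/
def rowSum {Ω : Type*} (N : ℕ) (X : ℕ → Ω → ℝ) (ω : Ω) : ℝ :=
  ∑ i ∈ Finset.Icc 1 N, X i ω

/-- The standard deviation of the sum of a row `X 1, ..., X N`. -/
noncomputable def rowSD {Ω : Type*} [MeasurableSpace Ω] (N : ℕ) (X : ℕ → Ω → ℝ)
    (μ : Measure Ω) : ℝ :=
  √(Var[rowSum N X; μ])

/-! Truncate each `X i` at `ε σ / m`, recentre, divide by `σ` and sum over blocks of length `m`. The
block sums are 1-dependent and bounded by `2 ε`. The discarded tails form an `m`-dependent centred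
row, so their sum has second moment at most three times the Lindeberg expression, which tends to 0
(`GapIndep.exists_isBoundedOneDependent`). It remains to treat 1-dependent sequences with a small
uniform bound.

For these, cut the sum greedily into pieces of variance about `δ`, dropping one variable between
pieces to make them independent. A small bound makes the dropped variables and the non-additivity of
the variance negligible, and there are `O(1/δ)` pieces, so each piece must match its Gaussian
characteristic function up to `o(δ)`. No Lindeberg condition is assumed for the pieces; it is
derived. If a piece exceeds `3 x`, its partial sums first leave `[-x, x]` at some time `k`, and the
sum after `k` is large and independent of that event. With a maximal inequality this bounds the
truncated second moment by a multiple of `δ² / x²` (`integral_sq_indicator_le`). Taking `δ = d ^ 4`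
and `x = d` gives error `O(d ^ 5)` per piece and `O(d)` in total
(`exists_forall_norm_charFun_segSum_sub_le`). Lévy's continuity theorem concludes. -/

/-- The σ-algebra generated by the variables `W i` with `i ∈ s`. -/
@[reducible]
def generatedBy {Ω : Type*} (W : ℕ → Ω → ℝ) (s : Set ℕ) : MeasurableSpace Ω :=
  ⨆ i ∈ s, MeasurableSpace.comap (W i) inferInstance

/-- The variables before time `k` are independent of those from time `k + m` on. -/
def GapIndep {Ω : Type*} [MeasurableSpace Ω] (m : ℕ) (W : ℕ → Ω → ℝ) (μ : Measure Ω) : Prop :=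
  ∀ k : ℕ, Indep (generatedBy W (Set.Iio k)) (generatedBy W (Set.Ici (k + m))) μ

/-- The sum of the variables with index in `[a, b)`. -/
def segSum {Ω : Type*} (W : ℕ → Ω → ℝ) (a b : ℕ) (ω : Ω) : ℝ := ∑ i ∈ Finset.Ico a b, W i ω

/-! ### Segment sums and second moments under 1-dependence. -/

section Segments

variable {Ω : Type*} {W : ℕ → Ω → ℝ}

lemma measurable_generatedBy {s : Set ℕ} {i : ℕ} (hi : i ∈ s) :
    Measurable[generatedBy W s] (W i) :=
  Measurable.mono (comap_measurable (W i)) (le_iSup₂_of_le i hi le_rfl) le_rfl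

lemma generatedBy_le_of_measurable [mΩ : MeasurableSpace Ω] {s : Set ℕ}
    (h : ∀ i ∈ s, Measurable (W i)) : generatedBy W s ≤ mΩ :=
  iSup₂_le fun i hi => (h i hi).comap_le

lemma measurable_segSum_generatedBy {s : Set ℕ} {a b : ℕ} (h : ∀ i ∈ Finset.Ico a b, i ∈ s) :
    Measurable[generatedBy W s] (segSum W a b) := by
  let := generatedBy W s
  exact Finset.measurable_fun_sum _ fun i hi => measurable_generatedBy (h i hi)

lemma segSum_self (a : ℕ) (ω : Ω) : segSum W a a ω = 0 := by simp [segSum]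

lemma segSum_of_le {a b : ℕ} (h : b ≤ a) (ω : Ω) : segSum W a b ω = 0 := by
  simp [segSum, Finset.Ico_eq_empty_of_le h]

lemma segSum_add_segSum {a b c : ℕ} (hab : a ≤ b) (hbc : b ≤ c) (ω : Ω) :
    segSum W a b ω + segSum W b c ω = segSum W a c ω :=
  Finset.sum_Ico_consecutive _ hab hbc

lemma segSum_succ {a b : ℕ} (hab : a ≤ b) (ω : Ω) :
    segSum W a (b + 1) ω = segSum W a b ω + W b ω :=
  Finset.sum_Ico_succ_top hab _

lemma segSum_singleton (b : ℕ) (ω : Ω) : segSum W b (b + 1) ω = W b ω := by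
  simp [segSum]

variable [MeasurableSpace Ω] {μ : Measure Ω}

lemma measurable_segSum (hW : ∀ i, Measurable (W i)) (a b : ℕ) : Measurable (segSum W a b) :=
  Finset.measurable_fun_sum _ fun _ _ => hW _

lemma memLp_segSum (hW : ∀ i, MemLp (W i) 2 μ) (a b : ℕ) : MemLp (segSum W a b) 2 μ :=
  memLp_finsetSum _ fun _ _ => hW _

lemma GapIndep.indepFun {m k : ℕ} (h : GapIndep m W μ) {f g : Ω → ℝ}
    (hf : Measurable[generatedBy W (Set.Iio k)] f)
    (hg : Measurable[generatedBy W (Set.Ici (k + m))] g) : IndepFun f g μ :=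
  (IndepFun_iff_Indep f g μ).2
    (indep_of_indep_of_le_right (indep_of_indep_of_le_left (h k) hf.comap_le) hg.comap_le)

lemma GapIndep.indepFun_segSum {m a b c d : ℕ} (h : GapIndep m W μ) (hbc : b + m ≤ c) :
    IndepFun (segSum W a b) (segSum W c d) μ :=
  h.indepFun (k := b)
    (measurable_segSum_generatedBy fun _ hi => (Finset.mem_Ico.1 hi).2)
    (measurable_segSum_generatedBy fun _ hi => hbc.trans (Finset.mem_Ico.1 hi).1)

variable [IsProbabilityMeasure μ]

lemma integral_segSum (hW : ∀ i, MemLp (W i) 2 μ) (h0 : ∀ i, ∫ ω, W i ω ∂μ = 0) (a b : ℕ) :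
    ∫ ω, segSum W a b ω ∂μ = 0 := by
  simp only [segSum]
  rw [integral_finsetSum _ fun i _ => (hW i).integrable (by norm_num)]
  simp [h0]

lemma GapIndep.integral_segSum_mul_segSum_eq_zero {m a b c d : ℕ} (h : GapIndep m W μ)
    (hW : ∀ i, MemLp (W i) 2 μ) (h0 : ∀ i, ∫ ω, W i ω ∂μ = 0) (hbc : b + m ≤ c) :
    ∫ ω, segSum W a b ω * segSum W c d ω ∂μ = 0 := by
  rw [(h.indepFun_segSum hbc).integral_fun_mul_eq_mul_integral
    (memLp_segSum hW a b).1 (memLp_segSum hW c d).1, integral_segSum hW h0, zero_mul]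

/-- Only the two variables adjacent to the cut are correlated; every other pair across it is
separated by a gap. -/
lemma GapIndep.integral_segSum_mul_segSum {a b c : ℕ} (h : GapIndep 1 W μ)
    (hW : ∀ i, MemLp (W i) 2 μ) (h0 : ∀ i, ∫ ω, W i ω ∂μ = 0) (hab : a ≤ b) (hbc : b + 2 ≤ c) :
    ∫ ω, segSum W a (b + 1) ω * segSum W (b + 1) c ω ∂μ = ∫ ω, W b ω * W (b + 1) ω ∂μ := by
  have hint : ∀ a b c d, Integrable (fun ω => segSum W a b ω * segSum W c d ω) μ :=
    fun a b c d => (memLp_segSum hW a b).integrable_mul (memLp_segSum hW c d)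
  have e : ∀ ω, segSum W a (b + 1) ω * segSum W (b + 1) c ω =
      segSum W a b ω * segSum W (b + 1) c ω + segSum W b (b + 1) ω * segSum W (b + 2) c ω
        + segSum W b (b + 1) ω * segSum W (b + 1) (b + 2) ω := fun ω => by
    rw [← segSum_add_segSum hab (Nat.le_succ b),
      ← segSum_add_segSum (Nat.le_succ (b + 1)) hbc]
    ring
  simp_rw [e]
  rw [integral_add ((hint _ _ _ _).fun_add (hint _ _ _ _)) (hint _ _ _ _),
    integral_add (hint _ _ _ _) (hint _ _ _ _),
    h.integral_segSum_mul_segSum_eq_zero hW h0 le_rfl,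
    h.integral_segSum_mul_segSum_eq_zero hW h0 le_rfl]
  simp [segSum_singleton]

/-- The second moment of a sum of `1`-dependent centred variables is at most three times the sum
of the second moments. -/
lemma GapIndep.integral_sq_segSum_le (h : GapIndep 1 W μ)
    (hW : ∀ i, MemLp (W i) 2 μ) (h0 : ∀ i, ∫ ω, W i ω ∂μ = 0) (n : ℕ) :
    ∫ ω, segSum W 0 n ω ^ 2 ∂μ ≤ 3 * ∑ i ∈ Finset.range n, ∫ ω, W i ω ^ 2 ∂μ := by
  have hsq : ∀ i, Integrable (fun ω => W i ω ^ 2) μ := fun i => (hW i).integrable_sq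
  have hS : ∀ n, Integrable (fun ω => segSum W 0 n ω ^ 2) μ :=
    fun n => (memLp_segSum hW 0 n).integrable_sq
  -- Coefficient 2 on the last term closes the induction: the new cross term costs one more copy of
  -- each of the last two second moments, turning `2, 0` into `3, 2`.
  have key : ∀ n, ∫ ω, segSum W 0 (n + 1) ω ^ 2 ∂μ ≤
      3 * ∑ i ∈ Finset.range n, ∫ ω, W i ω ^ 2 ∂μ + 2 * ∫ ω, W n ω ^ 2 ∂μ := by
    intro n
    induction n with
    | zero =>
      have : 0 ≤ ∫ ω, W 0 ω ^ 2 ∂μ := integral_nonneg fun ω => sq_nonneg _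
      simp only [segSum_singleton, Finset.range_zero, Finset.sum_empty]
      linarith
    | succ n ih =>
      have hm : Integrable (fun ω => segSum W 0 (n + 1) ω * segSum W (n + 1) (n + 2) ω) μ :=
        (memLp_segSum hW _ _).integrable_mul (memLp_segSum hW _ _)
      have e : ∀ ω, segSum W 0 (n + 2) ω ^ 2 = segSum W 0 (n + 1) ω ^ 2 +
          2 * (segSum W 0 (n + 1) ω * segSum W (n + 1) (n + 2) ω) + W (n + 1) ω ^ 2 := fun ω => by
        rw [segSum_succ (Nat.zero_le _), segSum_singleton]
        ring
      have hle : ∫ ω, W n ω * W (n + 1) ω ∂μ ≤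
          (∫ ω, W n ω ^ 2 ∂μ + ∫ ω, W (n + 1) ω ^ 2 ∂μ) / 2 := by
        rw [← integral_add (hsq _) (hsq _), ← integral_div]
        refine integral_mono ((hW _).integrable_mul (hW _))
          (((hsq _).add (hsq _)).div_const 2) fun ω => ?_
        dsimp only
        nlinarith [sq_nonneg (W n ω - W (n + 1) ω)]
      have e2 : ∫ ω, segSum W 0 (n + 2) ω ^ 2 ∂μ = ∫ ω, segSum W 0 (n + 1) ω ^ 2 ∂μ +
          2 * ∫ ω, W n ω * W (n + 1) ω ∂μ + ∫ ω, W (n + 1) ω ^ 2 ∂μ := by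
        simp_rw [e]
        rw [integral_add ((hS _).fun_add (hm.const_mul 2)) (hsq _),
          integral_add (hS _) (hm.const_mul 2), integral_const_mul,
          h.integral_segSum_mul_segSum hW h0 (Nat.zero_le _) le_rfl]
      rw [Finset.sum_range_succ]
      linarith
  rcases n with _ | n
  · simp [segSum_self]
  · have : 0 ≤ ∫ ω, W n ω ^ 2 ∂μ := integral_nonneg fun ω => sq_nonneg _
    rw [Finset.sum_range_succ]
    linarith [key n]

end Segments

/-! ### Bounded 1-dependent sequences: the variance is almost additive. -/

/-- A sequence of centred measurable `1`-dependent variables with values in `[-ε, ε]`. -/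
structure IsBoundedOneDependent {Ω : Type*} [MeasurableSpace Ω] (W : ℕ → Ω → ℝ) (ε : ℝ)
    (μ : Measure Ω) : Prop where
  measurable : ∀ i, Measurable (W i)
  bound : ∀ i ω, |W i ω| ≤ ε
  integral_eq_zero : ∀ i, ∫ ω, W i ω ∂μ = 0
  gapIndep : GapIndep 1 W μ

/-- The second moment of a segment sum. -/
noncomputable def segVar {Ω : Type*} [MeasurableSpace Ω] (W : ℕ → Ω → ℝ) (μ : Measure Ω)
    (a b : ℕ) : ℝ := ∫ ω, segSum W a b ω ^ 2 ∂μ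

lemma segVar_nonneg {Ω : Type*} [MeasurableSpace Ω] (W : ℕ → Ω → ℝ) (μ : Measure Ω)
    (a b : ℕ) : 0 ≤ segVar W μ a b :=
  integral_nonneg fun _ => sq_nonneg _

lemma segVar_of_le {Ω : Type*} [MeasurableSpace Ω] (W : ℕ → Ω → ℝ) (μ : Measure Ω)
    {a b : ℕ} (h : b ≤ a) : segVar W μ a b = 0 := by
  simp [segVar, segSum_of_le h]

namespace IsBoundedOneDependent

variable {Ω : Type*} [MeasurableSpace Ω] {W : ℕ → Ω → ℝ} {ε : ℝ} {μ : Measure Ω}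
  [IsProbabilityMeasure μ]

lemma nonneg (h : IsBoundedOneDependent W ε μ) : 0 ≤ ε := by
  obtain ⟨ω⟩ := nonempty_of_isProbabilityMeasure μ
  exact (abs_nonneg _).trans (h.bound 0 ω)

lemma memLp (h : IsBoundedOneDependent W ε μ) (i : ℕ) : MemLp (W i) 2 μ :=
  MemLp.of_bound (h.measurable i).aestronglyMeasurable ε (ae_of_all _ (h.bound i))

lemma segVar_succ_le (h : IsBoundedOneDependent W ε μ) (b : ℕ) :
    segVar W μ b (b + 1) ≤ ε ^ 2 := by
  have := integral_mono (μ := μ) (memLp_segSum h.memLp b (b + 1)).integrable_sq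
    (integrable_const (ε ^ 2)) fun ω => by
      simp only [segSum_singleton]
      exact sq_le_sq' (abs_le.1 (h.bound b ω)).1 (abs_le.1 (h.bound b ω)).2
  simpa [segVar] using this

lemma abs_segVar_sub_le (h : IsBoundedOneDependent W ε μ) {a b c : ℕ} (hab : a ≤ b)
    (hbc : b ≤ c) : |segVar W μ a c - segVar W μ a b - segVar W μ b c| ≤ 2 * ε ^ 2 := by
  have hm : Integrable (fun ω => segSum W a b ω * segSum W b c ω) μ :=
    (memLp_segSum h.memLp _ _).integrable_mul (memLp_segSum h.memLp _ _)
  have hS : ∀ a b, Integrable (fun ω => segSum W a b ω ^ 2) μ :=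
    fun a b => (memLp_segSum h.memLp a b).integrable_sq
  have e : segVar W μ a c =
      segVar W μ a b + 2 * ∫ ω, segSum W a b ω * segSum W b c ω ∂μ + segVar W μ b c := by
    have e : ∀ ω, segSum W a c ω ^ 2 = segSum W a b ω ^ 2 +
        2 * (segSum W a b ω * segSum W b c ω) + segSum W b c ω ^ 2 := fun ω => by
      rw [← segSum_add_segSum hab hbc]
      ring
    simp only [segVar]
    simp_rw [e]
    rw [integral_add ((hS _ _).fun_add (hm.const_mul 2)) (hS _ _),
      integral_add (hS _ _) (hm.const_mul 2), integral_const_mul]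
  have hb : |∫ ω, segSum W a b ω * segSum W b c ω ∂μ| ≤ ε ^ 2 := by
    rcases hab.eq_or_lt with rfl | hab
    · simpa [segSum_self] using sq_nonneg ε
    rcases hbc.eq_or_lt with rfl | hbc
    · simpa [segSum_self] using sq_nonneg ε
    obtain ⟨b, rfl⟩ : ∃ d, b = d + 1 := ⟨b - 1, by omega⟩
    rw [h.gapIndep.integral_segSum_mul_segSum h.memLp h.integral_eq_zero (by omega) (by omega)]
    have := norm_integral_le_of_norm_le_const (μ := μ) (C := ε ^ 2)
      (f := fun ω => W b ω * W (b + 1) ω) (ae_of_all _ fun ω => by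
        rw [Real.norm_eq_abs, abs_mul, sq]
        exact mul_le_mul (h.bound _ _) (h.bound _ _) (abs_nonneg _) h.nonneg)
    simpa using this
  rw [e, show segVar W μ a b + 2 * ∫ ω, segSum W a b ω * segSum W b c ω ∂μ + segVar W μ b c
    - segVar W μ a b - segVar W μ b c = 2 * ∫ ω, segSum W a b ω * segSum W b c ω ∂μ by ring,
    abs_mul, abs_two]
  linarith

/-- Two cuts cost `2 * ε ^ 2` each, and the dropped variable has variance at most `ε ^ 2`. -/
lemma abs_segVar_sub_skip_le (h : IsBoundedOneDependent W ε μ) {a b c : ℕ} (hab : a ≤ b)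
    (hbc : b ≤ c) : |segVar W μ a c - (segVar W μ a b + segVar W μ (b + 1) c)| ≤ 5 * ε ^ 2 := by
  rcases hbc.eq_or_lt with rfl | hbc
  · rw [segVar_of_le W μ (Nat.le_succ b)]
    simpa using sq_nonneg ε
  have h1 := abs_le.1 (h.abs_segVar_sub_le hab hbc.le)
  have h2 := abs_le.1 (h.abs_segVar_sub_le (Nat.le_succ b) hbc)
  have h3 := h.segVar_succ_le b
  have h4 := segVar_nonneg W μ b (b + 1)
  exact abs_le.2 ⟨by linarith [h1.1, h2.1], by linarith [h1.2, h2.2]⟩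

lemma abs_segSum_sub_skip_le (h : IsBoundedOneDependent W ε μ) {a b c : ℕ} (hab : a ≤ b)
    (hbc : b ≤ c) (ω : Ω) :
    |segSum W a c ω - (segSum W a b ω + segSum W (b + 1) c ω)| ≤ ε := by
  rcases hbc.eq_or_lt with rfl | hbc
  · rw [segSum_of_le (Nat.le_succ b)]
    simpa using h.nonneg
  rw [← segSum_add_segSum hab hbc.le, ← segSum_add_segSum (Nat.le_succ b) hbc, segSum_singleton]
  convert! h.bound b ω using 2
  ring

end IsBoundedOneDependent

/-! ### First passage times, a maximal inequality and truncated second moments. -/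

/-- The event that `k` is the first time at which the partial sums started at `a` leave
`[-x, x]`. -/
def firstPassage {Ω : Type*} (W : ℕ → Ω → ℝ) (x : ℝ) (a k : ℕ) : Set Ω :=
  {ω | (∀ j < k, |segSum W a j ω| ≤ x) ∧ x < |segSum W a k ω|}

section FirstPassage

variable {Ω : Type*} {W : ℕ → Ω → ℝ} {x : ℝ} {a b : ℕ}

/-- The stopping time property: the event involves only indices below `k`, so skipping `W k` makes
it independent of the sum from `k + 1` on. -/
lemma measurableSet_firstPassage (W : ℕ → Ω → ℝ) (x : ℝ) (a k : ℕ) :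
    MeasurableSet[generatedBy W (Set.Iio k)] (firstPassage W x a k) := by
  let := generatedBy W (Set.Iio k)
  have hm : ∀ j ≤ k, Measurable fun ω => |segSum W a j ω| := fun j hj =>
    (measurable_segSum_generatedBy fun i hi => (Finset.mem_Ico.1 hi).2.trans_le hj).abs
  have e : firstPassage W x a k =
      (⋂ j ∈ Set.Iio k, {ω | |segSum W a j ω| ≤ x}) ∩ {ω | x < |segSum W a k ω|} := by
    ext ω
    simp [firstPassage]
  rw [e]
  exact (MeasurableSet.biInter (Set.to_countable _) fun j hj =>
    measurableSet_le (hm j (le_of_lt hj)) measurable_const).inter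
      (measurableSet_lt measurable_const (hm k le_rfl))

lemma sum_indicator_firstPassage_le_one (s : Finset ℕ) (ω : Ω) :
    ∑ k ∈ s, (firstPassage W x a k).indicator (fun _ => (1 : ℝ)) ω ≤ 1 := by
  by_cases h : ∃ k ∈ s, ω ∈ firstPassage W x a k
  · obtain ⟨k, hk, hω⟩ := h
    rw [Finset.sum_eq_single_of_mem k hk]
    · simp [hω]
    · intro j _ hjk
      refine Set.indicator_of_notMem (fun hj => ?_) _
      rcases lt_or_gt_of_ne hjk with hlt | hlt
      · exact absurd (hω.1 j hlt) (not_le.2 hj.2)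
      · exact absurd (hj.1 k hlt) (not_le.2 hω.2)
  · push Not at h
    rw [Finset.sum_eq_zero fun k hk => Set.indicator_of_notMem (h k hk) _]
    exact zero_le_one

lemma exists_mem_firstPassage {ω : Ω} (hx : 0 ≤ x) (h : x < |segSum W a b ω|) :
    ∃ k ∈ Finset.Ioc a b, ω ∈ firstPassage W x a k := by
  classical
  have hex : ∃ k, x < |segSum W a k ω| := ⟨b, h⟩
  refine ⟨Nat.find hex, Finset.mem_Ioc.2 ⟨?_, Nat.find_min' hex h⟩,
    fun j hj => not_lt.1 (Nat.find_min hex hj), Nat.find_spec hex⟩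
  by_contra! hle
  have := Nat.find_spec hex
  rw [segSum_of_le hle, abs_zero] at this
  linarith

end FirstPassage

namespace IsBoundedOneDependent

variable {Ω : Type*} [MeasurableSpace Ω] {W : ℕ → Ω → ℝ} {ε x V : ℝ} {a b : ℕ} {μ : Measure Ω}
  [IsProbabilityMeasure μ]

omit [IsProbabilityMeasure μ] in
lemma abs_segSum_le_of_mem_firstPassage (h : IsBoundedOneDependent W ε μ) {k : ℕ} {ω : Ω}
    (hak : a < k) (hω : ω ∈ firstPassage W x a k) : |segSum W a k ω| ≤ x + ε := by
  obtain ⟨k, rfl⟩ : ∃ d, k = d + 1 := ⟨k - 1, by omega⟩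
  rw [segSum_succ (by omega)]
  exact (abs_add_le _ _).trans (add_le_add (hω.1 k (Nat.lt_succ_self k)) (h.bound k ω))

omit [IsProbabilityMeasure μ] in
lemma measurableSet_firstPassage (h : IsBoundedOneDependent W ε μ) (x : ℝ) (a k : ℕ) :
    MeasurableSet (firstPassage W x a k) :=
  generatedBy_le_of_measurable (fun i _ => h.measurable i) _
    (_root_.measurableSet_firstPassage W x a k)

omit [IsProbabilityMeasure μ] in
lemma integral_indicator_firstPassage_mul (h : IsBoundedOneDependent W ε μ) (x : ℝ)
    (a k b : ℕ) :
    ∫ ω, (firstPassage W x a k).indicator (fun _ => (1 : ℝ)) ω * segSum W (k + 1) b ω ^ 2 ∂μ =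
      μ.real (firstPassage W x a k) * segVar W μ (k + 1) b := by
  have hi : IndepFun ((firstPassage W x a k).indicator fun _ => (1 : ℝ))
      (fun ω => segSum W (k + 1) b ω ^ 2) μ := by
    have hA : Measurable[generatedBy W (Set.Iio k)]
        ((firstPassage W x a k).indicator fun _ => (1 : ℝ)) := by
      let := generatedBy W (Set.Iio k)
      exact measurable_const.indicator (_root_.measurableSet_firstPassage W x a k)
    have hR : Measurable[generatedBy W (Set.Ici (k + 1))]
        fun ω => segSum W (k + 1) b ω ^ 2 := by
      let := generatedBy W (Set.Ici (k + 1))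
      exact (measurable_segSum_generatedBy fun i hi => (Finset.mem_Ico.1 hi).1).pow_const 2
    exact h.gapIndep.indepFun hA hR
  rw [hi.integral_fun_mul_eq_mul_integral
    ((measurable_const.indicator (h.measurableSet_firstPassage x a k)).aestronglyMeasurable)
    (((measurable_segSum h.measurable _ _).pow_const 2).aestronglyMeasurable),
    integral_indicator_const _ (h.measurableSet_firstPassage x a k)]
  simp [segVar]

lemma integrable_indicator_firstPassage_mul (h : IsBoundedOneDependent W ε μ) (x : ℝ)
    (a k c b : ℕ) :
    Integrable (fun ω => (firstPassage W x a k).indicator (fun _ => (1 : ℝ)) ω *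
      segSum W c b ω ^ 2) μ := by
  have := (memLp_segSum h.memLp c b).integrable_sq.indicator (h.measurableSet_firstPassage x a k)
  refine this.congr (ae_of_all _ fun ω => ?_)
  by_cases hω : ω ∈ firstPassage W x a k <;> simp [hω]

lemma integral_sum_indicator_firstPassage_mul_le (h : IsBoundedOneDependent W ε μ)
    (hV : ∀ k, a ≤ k → segVar W μ k b ≤ V) :
    ∫ ω, ∑ k ∈ Finset.Ioc a b, (firstPassage W x a k).indicator (fun _ => (1 : ℝ)) ω *
      segSum W (k + 1) b ω ^ 2 ∂μ ≤ V * ∑ k ∈ Finset.Ioc a b, μ.real (firstPassage W x a k) := by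
  rw [integral_finsetSum _ fun k _ => h.integrable_indicator_firstPassage_mul x a k _ _,
    Finset.mul_sum]
  refine Finset.sum_le_sum fun k hk => ?_
  rw [h.integral_indicator_firstPassage_mul, mul_comm]
  exact mul_le_mul_of_nonneg_right (hV _ (by have := (Finset.mem_Ioc.1 hk).1; omega))
    measureReal_nonneg

lemma integral_sum_indicator_firstPassage (h : IsBoundedOneDependent W ε μ) :
    ∫ ω, ∑ k ∈ Finset.Ioc a b, (firstPassage W x a k).indicator (fun _ => (1 : ℝ)) ω ∂μ =
      ∑ k ∈ Finset.Ioc a b, μ.real (firstPassage W x a k) := by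
  rw [integral_finsetSum _ fun k _ =>
    (integrable_const (1 : ℝ)).indicator (h.measurableSet_firstPassage x a k)]
  refine Finset.sum_congr rfl fun k _ => ?_
  rw [integral_indicator_const _ (h.measurableSet_firstPassage x a k)]
  simp

/-- A maximal inequality of Ottaviani type. -/
lemma sum_measureReal_firstPassage_le (h : IsBoundedOneDependent W ε μ) (hx : 0 < x)
    (hεx : ε ≤ x / 4) (hV : ∀ k, a ≤ k → segVar W μ k b ≤ V) :
    ∑ k ∈ Finset.Ioc a b, μ.real (firstPassage W x a k) ≤ 20 * V / x ^ 2 := by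
  have hV0 : 0 ≤ V := (segVar_nonneg W μ a b).trans (hV a le_rfl)
  set I : ℕ → Ω → ℝ := fun k => (firstPassage W x a k).indicator fun _ => 1 with hI
  have hI0 : ∀ k ω, 0 ≤ I k ω := fun k ω => Set.indicator_nonneg (fun _ _ => zero_le_one) ω
  -- At first passage `|segSum W a k| > x`. Since `ε ≤ x / 4`, either the whole sum is at least `x /
  -- 2` in absolute value or the sum after `k` is at least `x / 4`; hence the factors 4 and 16.
  have hpt : ∀ k ∈ Finset.Ioc a b, ∀ ω, I k ω * x ^ 2 ≤
      4 * (I k ω * segSum W a b ω ^ 2) + 16 * (I k ω * segSum W (k + 1) b ω ^ 2) := by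
    intro k hk ω
    obtain ⟨hak, hkb⟩ := Finset.mem_Ioc.1 hk
    by_cases hω : ω ∈ firstPassage W x a k
    · simp only [hI, hω, Set.indicator_of_mem, one_mul]
      have h1 := h.abs_segSum_sub_skip_le hak.le hkb ω
      have h2 := hω.2
      rw [← sq_abs (segSum W a b ω), ← sq_abs (segSum W (k + 1) b ω)]
      have h3 : |segSum W a k ω| ≤
          |segSum W a b ω| + |segSum W (k + 1) b ω| + ε := by
        have h4 := abs_le.1 h1
        rcases abs_cases (segSum W a k ω) with h5 | h5 <;>
        rcases abs_cases (segSum W a b ω) with h6 | h6 <;>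
        rcases abs_cases (segSum W (k + 1) b ω) with h7 | h7 <;> linarith
      have hp := abs_nonneg (segSum W a b ω)
      have hq := abs_nonneg (segSum W (k + 1) b ω)
      rcases le_total (x / 2) |segSum W a b ω| with h8 | h8
      · nlinarith
      · have h9 : x / 4 ≤ |segSum W (k + 1) b ω| := by linarith
        nlinarith
    · simp [hI, hω]
  have hsum : ∀ ω, (∑ k ∈ Finset.Ioc a b, I k ω) * x ^ 2 ≤ 4 * segSum W a b ω ^ 2 +
      16 * ∑ k ∈ Finset.Ioc a b, I k ω * segSum W (k + 1) b ω ^ 2 := by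
    intro ω
    have h1 := Finset.sum_le_sum fun k hk => hpt k hk ω
    rw [← Finset.sum_mul, Finset.sum_add_distrib, ← Finset.mul_sum, ← Finset.mul_sum,
      ← Finset.sum_mul] at h1
    have h2 : (∑ k ∈ Finset.Ioc a b, I k ω) * segSum W a b ω ^ 2 ≤ 1 * segSum W a b ω ^ 2 :=
      mul_le_mul_of_nonneg_right (sum_indicator_firstPassage_le_one _ ω) (sq_nonneg _)
    linarith
  have hint : ∀ k, Integrable (I k) μ := fun k =>
    (integrable_const (1 : ℝ)).indicator (h.measurableSet_firstPassage x a k)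
  have hint2 : Integrable (fun ω => ∑ k ∈ Finset.Ioc a b, I k ω * segSum W (k + 1) b ω ^ 2) μ :=
    integrable_finsetSum _ fun k _ => h.integrable_indicator_firstPassage_mul x a k _ _
  have hZ := (memLp_segSum h.memLp a b).integrable_sq
  have hmono := integral_mono ((integrable_finsetSum (Finset.Ioc a b) fun k _ => hint k).mul_const
    (x ^ 2)) ((hZ.const_mul 4).add (hint2.const_mul 16)) hsum
  simp only [Pi.add_apply] at hmono
  rw [integral_add (hZ.const_mul 4) (hint2.const_mul 16), integral_const_mul, integral_const_mul,
    integral_mul_const, h.integral_sum_indicator_firstPassage] at hmono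
  have h3 := h.integral_sum_indicator_firstPassage_mul_le (x := x) hV
  -- The passage events are disjoint, so the total probability on the right is at most 1 and the
  -- bound becomes `4 V + 16 V = 20 V`.
  have h4 : ∑ k ∈ Finset.Ioc a b, μ.real (firstPassage W x a k) ≤ 1 := by
    rw [← h.integral_sum_indicator_firstPassage]
    have := integral_mono (μ := μ) (integrable_finsetSum (Finset.Ioc a b) fun k _ => hint k)
      (integrable_const (1 : ℝ)) fun ω => sum_indicator_firstPassage_le_one _ ω
    simpa using this
  have h5 := mul_le_mul_of_nonneg_left h4 hV0
  have h6 : ∫ ω, segSum W a b ω ^ 2 ∂μ ≤ V := hV a le_rfl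
  rw [le_div_iff₀ (by positivity)]
  linarith

/-- The truncated second moment of a segment sum is of the order of the square of its
variance. -/
lemma integral_sq_indicator_le (h : IsBoundedOneDependent W ε μ) (hx : 0 < x)
    (hεx : ε ≤ x / 4) (hV : ∀ k, a ≤ k → segVar W μ k b ≤ V) :
    ∫ ω, {ω | 3 * x < |segSum W a b ω|}.indicator (fun ω => segSum W a b ω ^ 2) ω ∂μ ≤
      80 * V ^ 2 / x ^ 2 := by
  have hV0 : 0 ≤ V := (segVar_nonneg W μ a b).trans (hV a le_rfl)
  have hms : MeasurableSet {ω | 3 * x < |segSum W a b ω|} :=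
    measurableSet_lt measurable_const (measurable_segSum h.measurable a b).abs
  -- At the passage time the partial sum is at most `x + ε`, so the later part is at least `|segSum
  -- W a b| - x - 2 ε`. This exceeds half of `|segSum W a b|` when that is above `3 x`; squaring
  -- gives the factor 4.
  have hpt : ∀ ω, {ω | 3 * x < |segSum W a b ω|}.indicator (fun ω => segSum W a b ω ^ 2) ω ≤
      4 * ∑ k ∈ Finset.Ioc a b, (firstPassage W x a k).indicator (fun _ => (1 : ℝ)) ω *
        segSum W (k + 1) b ω ^ 2 := by
    intro ω
    have hnn : ∀ k ∈ Finset.Ioc a b, 0 ≤ (firstPassage W x a k).indicator (fun _ => (1 : ℝ)) ω *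
        segSum W (k + 1) b ω ^ 2 := fun k _ =>
      mul_nonneg (Set.indicator_nonneg (fun _ _ => zero_le_one) ω) (sq_nonneg _)
    by_cases hω : 3 * x < |segSum W a b ω|
    · rw [Set.indicator_of_mem (by exact hω)]
      obtain ⟨k, hk, hkω⟩ := exists_mem_firstPassage hx.le
        (show x < |segSum W a b ω| by linarith)
      refine le_trans ?_ (mul_le_mul_of_nonneg_left (Finset.single_le_sum hnn hk) zero_le_four)
      rw [Set.indicator_of_mem hkω, one_mul]
      obtain ⟨hak, hkb⟩ := Finset.mem_Ioc.1 hk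
      have h1 := h.abs_segSum_sub_skip_le hak.le hkb ω
      have h2 := h.abs_segSum_le_of_mem_firstPassage hak hkω
      have h3 : |segSum W a b ω| ≤ |segSum W a k ω| + |segSum W (k + 1) b ω| + ε := by
        have h4 := abs_le.1 h1
        rcases abs_cases (segSum W a k ω) with h5 | h5 <;>
        rcases abs_cases (segSum W a b ω) with h6 | h6 <;>
        rcases abs_cases (segSum W (k + 1) b ω) with h7 | h7 <;> linarith
      rw [← sq_abs (segSum W a b ω), ← sq_abs (segSum W (k + 1) b ω)]
      nlinarith [abs_nonneg (segSum W a b ω), abs_nonneg (segSum W (k + 1) b ω)]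
    · rw [Set.indicator_of_notMem (by exact hω)]
      exact mul_nonneg zero_le_four (Finset.sum_nonneg hnn)
  have h1 := integral_mono ((memLp_segSum h.memLp a b).integrable_sq.indicator hms)
    ((integrable_finsetSum (Finset.Ioc a b) fun k _ =>
      h.integrable_indicator_firstPassage_mul x a k (k + 1) b).const_mul 4) hpt
  rw [integral_const_mul] at h1
  have h2 := h.integral_sum_indicator_firstPassage_mul_le (x := x) hV
  have h3 := mul_le_mul_of_nonneg_left (h.sum_measureReal_firstPassage_le hx hεx hV) hV0
  calc _ ≤ 4 * (V * (20 * V / x ^ 2)) := by linarith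
    _ = _ := by ring

end IsBoundedOneDependent

/-! ### Exponential estimates and expansion of characteristic functions. -/

lemma norm_cexp_sub_taylor_le (u : ℝ) :
    ‖Complex.exp (u * Complex.I) - (1 + u * Complex.I - u ^ 2 / 2)‖ ≤
      4 * min (|u| ^ 3) (u ^ 2) := by
  have hu0 := abs_nonneg u
  rcases le_total |u| 1 with hu | hu
  · have hn : ‖(u * Complex.I : ℂ)‖ = |u| := by simp
    have h := Complex.exp_bound (x := u * Complex.I) (by rwa [hn]) (n := 3) (by norm_num)
    rw [hn] at h
    have e : ∑ m ∈ Finset.range 3, (u * Complex.I : ℂ) ^ m / (m.factorial : ℂ) =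
        1 + u * Complex.I - u ^ 2 / 2 := by
      simp [Finset.sum_range_succ, mul_pow]
      ring
    rw [e] at h
    have h3 : |u| ^ 3 ≤ u ^ 2 := by
      rw [← sq_abs u]
      nlinarith [sq_nonneg |u|]
    rw [min_eq_left h3]
    refine h.trans ?_
    norm_num [Nat.factorial]
    nlinarith [pow_nonneg hu0 3]
  · have h3 : u ^ 2 ≤ |u| ^ 3 := by
      rw [← sq_abs u]
      nlinarith [sq_nonneg |u|]
    rw [min_eq_right h3]
    have h1 : ‖(1 + u * Complex.I - u ^ 2 / 2 : ℂ)‖ ≤ 1 + |u| + u ^ 2 / 2 := by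
      refine (norm_sub_le _ _).trans (add_le_add ((norm_add_le _ _).trans ?_) ?_) <;> simp
    have h2 := norm_sub_le (Complex.exp (u * Complex.I)) (1 + u * Complex.I - u ^ 2 / 2)
    rw [Complex.norm_exp_ofReal_mul_I] at h2
    have h4 : |u| ^ 2 = u ^ 2 := sq_abs u
    nlinarith

lemma norm_cexp_ofReal_mul_I_sub_le (u w : ℝ) :
    ‖Complex.exp (u * Complex.I) - Complex.exp (w * Complex.I)‖ ≤ |u - w| := by
  have e : Complex.exp (u * Complex.I) - Complex.exp (w * Complex.I) =
      Complex.exp (w * Complex.I) * (Complex.exp (Complex.I * ((u - w : ℝ) : ℂ)) - 1) := by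
    rw [mul_sub, ← Complex.exp_add, mul_one]
    congr 2
    push_cast
    ring
  rw [e, norm_mul, Complex.norm_exp_ofReal_mul_I, one_mul]
  exact Real.norm_exp_I_mul_ofReal_sub_one_le

lemma abs_exp_neg_sub_exp_neg_le {u w : ℝ} (hu : 0 ≤ u) (hw : 0 ≤ w) :
    |Real.exp (-u) - Real.exp (-w)| ≤ |u - w| := by
  wlog h : u ≤ w generalizing u w
  · rw [abs_sub_comm, abs_sub_comm u]
    exact this hw hu (le_of_not_ge h)
  have h1 : Real.exp (-w) ≤ Real.exp (-u) := Real.exp_le_exp.2 (by linarith)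
  have h2 : Real.exp (-w) = Real.exp (-u) * Real.exp (u - w) := by
    rw [← Real.exp_add]
    congr 1
    ring
  have h3 : Real.exp (-u) ≤ 1 := Real.exp_le_one_iff.2 (by linarith)
  have h4 := Real.add_one_le_exp (u - w)
  have h5 := Real.exp_pos (-u)
  rw [abs_of_nonneg (by linarith), abs_of_nonpos (by linarith), h2]
  nlinarith

lemma abs_exp_neg_sub_one_sub_le {u : ℝ} (hu : 0 ≤ u) :
    |Real.exp (-u) - (1 - u)| ≤ u ^ 2 := by
  have h1 := Real.add_one_le_exp (-u)
  have h2 := Real.add_one_le_exp u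
  rw [abs_of_nonneg (by linarith)]
  have h3 : Real.exp (-u) * Real.exp u = 1 := by rw [← Real.exp_add]; simp
  have h4 := Real.exp_pos (-u)
  have h5 : Real.exp (-u) * (1 + u) ≤ 1 := by nlinarith
  by_contra! h
  nlinarith [pow_nonneg hu 3]

section CharFun

variable {Ω : Type*} [MeasurableSpace Ω] {μ : Measure Ω} [IsProbabilityMeasure μ]

omit [IsProbabilityMeasure μ] in
lemma charFun_map_eq_integral {Z : Ω → ℝ} (hZ : AEMeasurable Z μ) (t : ℝ) :
    charFun (μ.map Z) t = ∫ ω, Complex.exp ((t * Z ω : ℝ) * Complex.I) ∂μ := by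
  rw [charFun_apply_real, integral_map hZ (by fun_prop)]
  simp

lemma integrable_cexp_ofReal_mul_I {Z : Ω → ℝ} (hZ : AEMeasurable Z μ) :
    Integrable (fun ω => Complex.exp (Z ω * Complex.I)) μ := by
  refine Integrable.of_bound (C := 1) ?_ (ae_of_all _ fun ω => by
    rw [Complex.norm_exp_ofReal_mul_I])
  exact (Complex.measurable_exp.comp_aemeasurable
    ((Complex.measurable_ofReal.comp_aemeasurable hZ).mul_const _)).aestronglyMeasurable

lemma norm_charFun_map_sub_le {Z Z' : Ω → ℝ} (hZ : AEMeasurable Z μ) (hZ' : AEMeasurable Z' μ)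
    (hd : Integrable (fun ω => |Z ω - Z' ω|) μ) (t : ℝ) :
    ‖charFun (μ.map Z) t - charFun (μ.map Z') t‖ ≤ |t| * ∫ ω, |Z ω - Z' ω| ∂μ := by
  rw [charFun_map_eq_integral hZ, charFun_map_eq_integral hZ',
    ← integral_sub (integrable_cexp_ofReal_mul_I (hZ.const_mul t))
      (integrable_cexp_ofReal_mul_I (hZ'.const_mul t)), ← integral_const_mul]
  refine norm_integral_le_of_norm_le (hd.const_mul _) (ae_of_all _ fun ω => ?_)
  refine (norm_cexp_ofReal_mul_I_sub_le _ _).trans ?_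
  rw [← mul_sub, abs_mul]

/-- A second order expansion of the characteristic function of a centred variable. -/
lemma norm_charFun_map_sub_taylor_le {Z : Ω → ℝ} (hZ : MemLp Z 2 μ) (hZm : Measurable Z)
    (h0 : ∫ ω, Z ω ∂μ = 0) {y : ℝ} (hy : 0 ≤ y) (t : ℝ) :
    ‖charFun (μ.map Z) t - ((1 - t ^ 2 / 2 * ∫ ω, Z ω ^ 2 ∂μ : ℝ) : ℂ)‖ ≤
      4 * (|t| ^ 3 * y * ∫ ω, Z ω ^ 2 ∂μ +
        t ^ 2 * ∫ ω, {ω | y < |Z ω|}.indicator (fun ω => Z ω ^ 2) ω ∂μ) := by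
  have hms : MeasurableSet {ω | y < |Z ω|} := measurableSet_lt measurable_const hZm.abs
  have hsq := hZ.integrable_sq
  have hind := hsq.indicator hms
  have h1 : Integrable (fun ω => (1 : ℂ) + (t * Z ω : ℝ) * Complex.I - (t * Z ω : ℝ) ^ 2 / 2) μ := by
    have e : ∀ ω, (1 : ℂ) + (t * Z ω : ℝ) * Complex.I - (t * Z ω : ℝ) ^ 2 / 2 =
        1 + ((t * Z ω : ℝ) : ℂ) * Complex.I - ((t ^ 2 / 2 * Z ω ^ 2 : ℝ) : ℂ) := fun ω => by
      push_cast
      ring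
    simp_rw [e]
    exact ((integrable_const _).add ((((hZ.integrable (by norm_num)).const_mul t).ofReal).mul_const
      _)).sub (hsq.const_mul _).ofReal
  have h2 : ∫ ω, ((1 : ℂ) + (t * Z ω : ℝ) * Complex.I - (t * Z ω : ℝ) ^ 2 / 2) ∂μ =
      ((1 - t ^ 2 / 2 * ∫ ω, Z ω ^ 2 ∂μ : ℝ) : ℂ) := by
    have e : ∀ ω, (1 : ℂ) + (t * Z ω : ℝ) * Complex.I - (t * Z ω : ℝ) ^ 2 / 2 =
        ((1 - t ^ 2 / 2 * Z ω ^ 2 : ℝ) : ℂ) + ((t * Z ω : ℝ) : ℂ) * Complex.I := fun ω => by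
      push_cast
      ring
    simp_rw [e]
    rw [integral_add ((integrable_const _).sub (hsq.const_mul _)).ofReal
      ((((hZ.integrable (by norm_num)).const_mul t).ofReal).mul_const _), integral_mul_const,
      integral_complex_ofReal, integral_complex_ofReal, integral_const_mul, h0,
      integral_sub (integrable_const _) (hsq.const_mul _), integral_const_mul]
    simp
  rw [charFun_map_eq_integral hZm.aemeasurable, ← h2,
    ← integral_sub (integrable_cexp_ofReal_mul_I (hZm.aemeasurable.const_mul t)) h1,
    ← integral_const_mul, ← integral_const_mul, ← integral_add (hsq.const_mul _)
      (hind.const_mul _), ← integral_const_mul]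
  refine norm_integral_le_of_norm_le (((hsq.const_mul _).add (hind.const_mul _)).const_mul 4)
    (ae_of_all _ fun ω => ?_)
  refine (norm_cexp_sub_taylor_le _).trans (mul_le_mul_of_nonneg_left ?_ zero_le_four)
  -- The quadratic bound serves on the tail, the cubic one elsewhere.
  by_cases hω : y < |Z ω|
  · rw [Set.indicator_of_mem (by exact hω)]
    refine (min_le_right _ _).trans ?_
    have : 0 ≤ |t| ^ 3 * y * Z ω ^ 2 := by positivity
    nlinarith
  · rw [Set.indicator_of_notMem (by exact hω), mul_zero, add_zero]
    refine (min_le_left _ _).trans ?_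
    rw [abs_mul, mul_pow, mul_assoc, ← sq_abs (Z ω)]
    refine mul_le_mul_of_nonneg_left ?_ (by positivity)
    nlinarith [sq_nonneg |Z ω|]

end CharFun

/-- The characteristic function of the centred Gaussian law with variance `v`. -/
noncomputable def gaussianChar (t v : ℝ) : ℂ := (Real.exp (-(t ^ 2 / 2 * v)) : ℝ)

lemma norm_gaussianChar_le_one (t : ℝ) {v : ℝ} (hv : 0 ≤ v) : ‖gaussianChar t v‖ ≤ 1 := by
  rw [gaussianChar, Complex.norm_real, Real.norm_eq_abs, abs_of_pos (Real.exp_pos _),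
    Real.exp_le_one_iff, neg_nonpos]
  positivity

lemma gaussianChar_add (t v w : ℝ) :
    gaussianChar t (v + w) = gaussianChar t v * gaussianChar t w := by
  rw [gaussianChar, gaussianChar, gaussianChar, ← Complex.ofReal_mul, ← Real.exp_add]
  congr 3
  ring

lemma norm_gaussianChar_sub_le (t : ℝ) {v w : ℝ} (hv : 0 ≤ v) (hw : 0 ≤ w) :
    ‖gaussianChar t v - gaussianChar t w‖ ≤ t ^ 2 / 2 * |v - w| := by
  rw [gaussianChar, gaussianChar, ← Complex.ofReal_sub, Complex.norm_real, Real.norm_eq_abs]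
  refine (abs_exp_neg_sub_exp_neg_le (by positivity) (by positivity)).trans ?_
  rw [← mul_sub, abs_mul, abs_of_nonneg (by positivity : 0 ≤ t ^ 2 / 2)]

/-! ### Gaussian approximation for bounded 1-dependent sums. -/

namespace IsBoundedOneDependent

variable {Ω : Type*} [MeasurableSpace Ω] {W : ℕ → Ω → ℝ} {ε : ℝ} {μ : Measure Ω}
  [IsProbabilityMeasure μ]

lemma norm_charFun_segSum_sub_small_le (h : IsBoundedOneDependent W ε μ) {x V : ℝ} {a b : ℕ}
    (hx : 0 < x) (hεx : ε ≤ x / 4) (hV : segVar W μ a b + 2 * ε ^ 2 ≤ V) (t : ℝ) :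
    ‖charFun (μ.map (segSum W a b)) t - gaussianChar t (segVar W μ a b)‖ ≤
      4 * (|t| ^ 3 * (3 * x) * V + t ^ 2 * (80 * V ^ 2 / x ^ 2)) + t ^ 4 * V ^ 2 := by
  have hv0 := segVar_nonneg W μ a b
  have hvV : segVar W μ a b ≤ V := by nlinarith [sq_nonneg ε]
  have hV0 : 0 ≤ V := hv0.trans hvV
  -- The maximal inequality needs every final segment to have variance at most `V`; the margin `2 *
  -- ε ^ 2` covers the lack of monotonicity.
  have hV' : ∀ k, a ≤ k → segVar W μ k b ≤ V := by
    intro k hak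
    rcases le_total b k with hbk | hkb
    · rw [segVar_of_le W μ hbk]
      exact hV0
    · have h1 := abs_le.1 (h.abs_segVar_sub_le hak hkb)
      linarith [h1.1, segVar_nonneg W μ a k]
  have h1 := norm_charFun_map_sub_taylor_le (memLp_segSum h.memLp a b)
    (measurable_segSum h.measurable a b) (integral_segSum h.memLp h.integral_eq_zero a b)
    (by positivity : 0 ≤ 3 * x) t
  have h2 := h.integral_sq_indicator_le hx hεx hV'
  have h3 : ‖((1 - t ^ 2 / 2 * segVar W μ a b : ℝ) : ℂ) - gaussianChar t (segVar W μ a b)‖ ≤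
      t ^ 4 * V ^ 2 := by
    rw [gaussianChar, ← Complex.ofReal_sub, Complex.norm_real, Real.norm_eq_abs, abs_sub_comm]
    refine (abs_exp_neg_sub_one_sub_le (by positivity)).trans ?_
    have h4 : segVar W μ a b ^ 2 ≤ V ^ 2 := pow_le_pow_left₀ hv0 hvV 2
    have h5 : 0 ≤ t ^ 4 := by positivity
    nlinarith [mul_le_mul_of_nonneg_left h4 h5, mul_nonneg h5 (sq_nonneg V)]
  refine (norm_sub_le_norm_sub_add_norm_sub _ _ _).trans (add_le_add (h1.trans ?_) h3)
  refine mul_le_mul_of_nonneg_left (add_le_add ?_ ?_) zero_le_four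
  · exact mul_le_mul_of_nonneg_left hvV (by positivity)
  · exact mul_le_mul_of_nonneg_left h2 (by positivity)

lemma norm_charFun_segSum_sub_skip_le (h : IsBoundedOneDependent W ε μ) {a b c : ℕ}
    (hab : a ≤ b) (hbc : b ≤ c) (t : ℝ) :
    ‖charFun (μ.map (segSum W a c)) t - charFun (μ.map (segSum W a b)) t *
      charFun (μ.map (segSum W (b + 1) c)) t‖ ≤ |t| * ε := by
  have hm := measurable_segSum h.measurable
  rw [← Pi.mul_apply, ← (h.gapIndep.indepFun_segSum le_rfl).charFun_map_fun_add_eq_mul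
    (hm a b).aemeasurable (hm (b + 1) c).aemeasurable]
  have hi : Integrable
      (fun ω => |segSum W a c ω - (segSum W a b ω + segSum W (b + 1) c ω)|) μ :=
    Integrable.of_bound (C := ε)
      ((hm a c).sub ((hm a b).add (hm (b + 1) c))).abs.aestronglyMeasurable
      (ae_of_all _ fun ω => by
        rw [Real.norm_eq_abs, abs_abs]
        exact h.abs_segSum_sub_skip_le hab hbc ω)
  refine (norm_charFun_map_sub_le (hm a c).aemeasurable
    ((hm a b).add (hm (b + 1) c)).aemeasurable hi t).trans
    (mul_le_mul_of_nonneg_left ?_ (abs_nonneg t))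
  have := integral_mono hi (integrable_const ε) (h.abs_segSum_sub_skip_le hab hbc)
  simpa using this

/-- Cut off the shortest initial piece of variance at least `δ`, drop the next variable, and
recurse. Each cut lowers the remaining variance by at least `δ - 5 * ε ^ 2 ≥ δ / 2`, so there are at
most `2 * segVar W μ a n / δ` cuts, plus a last piece. The three errors per cut come from the piece
itself, the dropped variable and the non-additive variance. -/
lemma norm_charFun_segSum_sub_le (h : IsBoundedOneDependent W ε μ) {δ e t : ℝ} (hδ : 0 < δ)
    (hεδ : 5 * ε ^ 2 ≤ δ / 2) (he : 0 ≤ e)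
    (hsmall : ∀ a b, a ≤ b → segVar W μ a b ≤ δ + 3 * ε ^ 2 →
      ‖charFun (μ.map (segSum W a b)) t - gaussianChar t (segVar W μ a b)‖ ≤ e) (n a : ℕ) :
    ‖charFun (μ.map (segSum W a n)) t - gaussianChar t (segVar W μ a n)‖ ≤
      (2 * segVar W μ a n / δ + 1) * (e + |t| * ε + t ^ 2 / 2 * (5 * ε ^ 2)) := by
  have hε := h.nonneg
  set E := e + |t| * ε + t ^ 2 / 2 * (5 * ε ^ 2) with hE
  have hE0 : 0 ≤ |t| * ε + t ^ 2 / 2 * (5 * ε ^ 2) := by positivity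
  have heE : e ≤ E := by linarith
  have hpos : ∀ a, 0 ≤ 2 * segVar W μ a n / δ := fun a =>
    div_nonneg (mul_nonneg zero_le_two (segVar_nonneg W μ a n)) hδ.le
  induction hd : n + 1 - a using Nat.strong_induction_on generalizing a with
  | _ d ih =>
  rcases lt_or_ge n a with hna | han
  · rw [segVar_of_le W μ hna.le]
    have e1 : segSum W a n = fun _ => 0 := funext (segSum_of_le hna.le)
    rw [charFun_map_eq_integral (measurable_segSum h.measurable a n).aemeasurable, e1]
    simp only [gaussianChar, mul_zero, Complex.ofReal_zero, zero_mul, Complex.exp_zero, neg_zero,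
      Real.exp_zero, Complex.ofReal_one, integral_const, probReal_univ, one_smul, sub_self,
      norm_zero, zero_div, zero_add, one_mul]
    linarith
  by_cases hex : ∃ b, a ≤ b ∧ b ≤ n ∧ δ ≤ segVar W μ a b
  · classical
    set b := Nat.find hex with hb
    obtain ⟨hab, hbn, hbδ⟩ := Nat.find_spec hex
    rw [← hb] at hab hbn hbδ
    have hab' : a < b := by
      refine lt_of_le_of_ne hab fun heq => ?_
      rw [← heq, segVar_of_le W μ le_rfl] at hbδ
      linarith
    -- By minimality the piece without its last variable has variance below `δ`; that variable adds
    -- at most `ε ^ 2 + 2 * ε ^ 2`.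
    have hblock : segVar W μ a b ≤ δ + 3 * ε ^ 2 := by
      obtain ⟨c, hc⟩ : ∃ c, b = c + 1 := ⟨b - 1, by omega⟩
      have h1 := Nat.find_min hex (m := c) (by omega)
      push Not at h1
      have h2 := h1 (by omega) (by omega)
      have h3 := (abs_le.1 (h.abs_segVar_sub_le (show a ≤ c by omega) (Nat.le_succ c))).2
      have h4 := h.segVar_succ_le c
      rw [hc]
      linarith
    have hI := ih (n + 1 - (b + 1)) (by omega) (b + 1) rfl
    have hS := hsmall a b hab hblock
    have hskip := h.norm_charFun_segSum_sub_skip_le hab hbn t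
    have hvar := h.abs_segVar_sub_skip_le hab hbn
    have hG := (norm_gaussianChar_sub_le t (segVar_nonneg W μ a n)
      (add_nonneg (segVar_nonneg W μ a b) (segVar_nonneg W μ (b + 1) n))).trans
      (mul_le_mul_of_nonneg_left hvar (by positivity))
    rw [gaussianChar_add] at hG
    have : IsProbabilityMeasure (μ.map (segSum W (b + 1) n)) :=
      Measure.isProbabilityMeasure_map (measurable_segSum h.measurable _ _).aemeasurable
    have hprod : ‖charFun (μ.map (segSum W a b)) t * charFun (μ.map (segSum W (b + 1) n)) t -
        gaussianChar t (segVar W μ a b) * gaussianChar t (segVar W μ (b + 1) n)‖ ≤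
        e + (2 * segVar W μ (b + 1) n / δ + 1) * E := by
      have e1 : ∀ p q r s : ℂ, p * q - r * s = (p - r) * q + r * (q - s) := fun p q r s => by ring
      rw [e1]
      refine (norm_add_le _ _).trans (add_le_add ?_ ?_)
      · rw [norm_mul]
        exact (mul_le_of_le_one_right (norm_nonneg _) (norm_charFun_le_one t)).trans hS
      · rw [norm_mul]
        exact (mul_le_of_le_one_left (norm_nonneg _)
          (norm_gaussianChar_le_one t (segVar_nonneg W μ a b))).trans hI
    have htot : ‖charFun (μ.map (segSum W a n)) t - gaussianChar t (segVar W μ a n)‖ ≤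
        (2 * segVar W μ (b + 1) n / δ + 1) * E + E := by
      rw [norm_sub_rev] at hG
      have h1 := norm_sub_le_norm_sub_add_norm_sub (charFun (μ.map (segSum W a n)) t)
        (charFun (μ.map (segSum W a b)) t * charFun (μ.map (segSum W (b + 1) n)) t)
        (gaussianChar t (segVar W μ a n))
      have h2 := norm_sub_le_norm_sub_add_norm_sub
        (charFun (μ.map (segSum W a b)) t * charFun (μ.map (segSum W (b + 1) n)) t)
        (gaussianChar t (segVar W μ a b) * gaussianChar t (segVar W μ (b + 1) n))
        (gaussianChar t (segVar W μ a n))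
      linarith
    refine htot.trans ?_
    have h1 : 2 * segVar W μ (b + 1) n / δ + 1 ≤ 2 * segVar W μ a n / δ := by
      rw [div_add_one hδ.ne']
      refine div_le_div_of_nonneg_right ?_ hδ.le
      linarith [(abs_le.1 hvar).1]
    nlinarith
  · push Not at hex
    have h1 := hsmall a n han ((hex n han le_rfl).le.trans (by nlinarith [sq_nonneg ε]))
    nlinarith [hpos a]

end IsBoundedOneDependent

/-- For sums of bounded `1`-dependent variables with variance at most `2`, the characteristic
function is close to the Gaussian one as soon as the bound is small. -/
theorem exists_forall_norm_charFun_segSum_sub_le (t : ℝ) {τ : ℝ} (hτ : 0 < τ) :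
    ∃ ε₀ : ℝ, 0 < ε₀ ∧ ∀ {Ω : Type*} [MeasurableSpace Ω] {W : ℕ → Ω → ℝ} {μ : Measure Ω}
      [IsProbabilityMeasure μ] (n : ℕ), IsBoundedOneDependent W ε₀ μ → segVar W μ 0 n ≤ 2 →
      ‖charFun (μ.map (segSum W 0 n)) t - gaussianChar t (segVar W μ 0 n)‖ ≤ τ := by
  set C := 24 * |t| ^ 3 + 1280 * t ^ 2 + 4 * t ^ 4 with hC
  have hC0 : 0 ≤ C := by positivity
  -- Pieces have variance about `d ^ 4` and error at most `C * d ^ 5`, and the count is at most `5 /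
  -- d ^ 4`, whence `5 * C * d`. The bound `ε` is chosen after `d`, to absorb the cutting errors.
  obtain ⟨d, hd0, hd1, hdC⟩ : ∃ d : ℝ, 0 < d ∧ d ≤ 1 ∧ 5 * C * d ≤ τ / 2 := by
    refine ⟨min 1 (τ / (10 * (C + 1))), by positivity, min_le_left _ _, ?_⟩
    have h1 : 5 * C * min 1 (τ / (10 * (C + 1))) ≤ 5 * (C + 1) * (τ / (10 * (C + 1))) := by
      refine mul_le_mul (by linarith) (min_le_right _ _) (by positivity) (by positivity)
    refine h1.trans (le_of_eq ?_)
    field_simp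
    norm_num
  set D := |t| + t ^ 2 / 2 * 5 with hD
  have hD0 : 0 ≤ D := by positivity
  obtain ⟨ε, hε0, hε1, hε2⟩ : ∃ ε : ℝ, 0 < ε ∧ ε ≤ d ^ 4 / 10 ∧ 5 / d ^ 4 * (D * ε) ≤ τ / 2 := by
    refine ⟨min (d ^ 4 / 10) (τ * d ^ 4 / (10 * (D + 1))), by positivity, min_le_left _ _, ?_⟩
    have h1 : D * min (d ^ 4 / 10) (τ * d ^ 4 / (10 * (D + 1))) ≤
        (D + 1) * (τ * d ^ 4 / (10 * (D + 1))) :=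
      mul_le_mul (by linarith) (min_le_right _ _) (by positivity) (by positivity)
    refine (mul_le_mul_of_nonneg_left h1 (by positivity)).trans (le_of_eq ?_)
    field_simp
    norm_num
  refine ⟨ε, hε0, ?_⟩
  intro Ω _ W μ _ n h hv
  have hd4 : 0 < d ^ 4 := by positivity
  have hd41 : d ^ 4 ≤ 1 := pow_le_one₀ hd0.le hd1
  have hd4d : d ^ 4 ≤ d := pow_le_of_le_one hd0.le hd1 (by norm_num)
  have hεsq : ε ^ 2 ≤ ε := by nlinarith
  have hεδ : 5 * ε ^ 2 ≤ d ^ 4 / 2 := by linarith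
  have hsmall : ∀ a b, a ≤ b → segVar W μ a b ≤ d ^ 4 + 3 * ε ^ 2 →
      ‖charFun (μ.map (segSum W a b)) t - gaussianChar t (segVar W μ a b)‖ ≤ C * d ^ 5 := by
    intro a b hab hvab
    refine (h.norm_charFun_segSum_sub_small_le hd0 (by linarith)
      (V := 2 * d ^ 4) (by linarith) t).trans ?_
    have e1 : 4 * (|t| ^ 3 * (3 * d) * (2 * d ^ 4) + t ^ 2 * (80 * (2 * d ^ 4) ^ 2 / d ^ 2)) +
        t ^ 4 * (2 * d ^ 4) ^ 2 =
        24 * |t| ^ 3 * d ^ 5 + 1280 * t ^ 2 * d ^ 6 + 4 * t ^ 4 * d ^ 8 := by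
      field_simp
      ring
    have h6 : d ^ 6 ≤ d ^ 5 := pow_le_pow_of_le_one hd0.le hd1 (by norm_num)
    have h8 : d ^ 8 ≤ d ^ 5 := pow_le_pow_of_le_one hd0.le hd1 (by norm_num)
    rw [e1, hC, add_mul, add_mul]
    gcongr
  refine (h.norm_charFun_segSum_sub_le hd4 hεδ (by positivity) hsmall n 0).trans ?_
  have h1 : 2 * segVar W μ 0 n / d ^ 4 + 1 ≤ 5 / d ^ 4 := by
    rw [div_add_one hd4.ne']
    exact div_le_div_of_nonneg_right (by linarith) hd4.le
  have h2 : C * d ^ 5 + |t| * ε + t ^ 2 / 2 * (5 * ε ^ 2) ≤ C * d ^ 5 + D * ε := by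
    have := mul_le_mul_of_nonneg_left hεsq (by positivity : 0 ≤ t ^ 2 / 2 * 5)
    rw [hD]
    linarith
  have h3 : 0 ≤ C * d ^ 5 + D * ε := by positivity
  calc _ ≤ 5 / d ^ 4 * (C * d ^ 5 + D * ε) :=
        mul_le_mul h1 h2 (by positivity) (by positivity)
    _ = 5 * C * d + 5 / d ^ 4 * (D * ε) := by
        field_simp
    _ ≤ τ := by linarith

/-! ### Reduction of `m`-dependent rows by truncation and blocking. -/

section GapIndep

variable {Ω : Type*} [MeasurableSpace Ω] {μ : Measure Ω} [IsProbabilityMeasure μ]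

/-- `m`-dependence of a finite row, stated with σ-algebras for a modification of the row that is
continued by zeros. -/
lemma IsMDependent.gapIndep {m N : ℕ} {X X' : ℕ → Ω → ℝ}
    (h : IsMDependent m (Set.Icc 1 N) X μ) (hX : ∀ i ∈ Set.Icc 1 N, X i =ᵐ[μ] X' i)
    (h0 : ∀ i ∉ Set.Icc 1 N, X' i = 0) : GapIndep m X' μ := by
  have hle : ∀ {p : ℕ → Prop} {s : Set ℕ}, (∀ i ∈ s, p i) →
      generatedBy X' s ≤ MeasurableSpace.comap
        (fun ω (i : {i : ℕ // i ∈ Set.Icc 1 N ∧ p i}) => X' i ω) inferInstance := by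
    intro p s hs
    refine iSup₂_le fun i hi => ?_
    by_cases hiN : i ∈ Set.Icc 1 N
    · have : X' i = (fun f : {i : ℕ // i ∈ Set.Icc 1 N ∧ p i} → ℝ => f ⟨i, hiN, hs i hi⟩) ∘
          (fun ω (i : {i : ℕ // i ∈ Set.Icc 1 N ∧ p i}) => X' i ω) := rfl
      rw [this, ← MeasurableSpace.comap_comp]
      exact MeasurableSpace.comap_mono (measurable_pi_apply _).comap_le
    · rw [h0 i hiN]
      exact Measurable.comap_le (@measurable_const _ _ _ (MeasurableSpace.comap
        (fun ω (i : {i : ℕ // i ∈ Set.Icc 1 N ∧ p i}) => X' i ω) inferInstance) 0)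
  have hae : ∀ p : ℕ → Prop, (fun ω (i : {i : ℕ // i ∈ Set.Icc 1 N ∧ p i}) => X i ω) =ᵐ[μ]
      fun ω (i : {i : ℕ // i ∈ Set.Icc 1 N ∧ p i}) => X' i ω := by
    intro p
    have : ∀ᵐ ω ∂μ, ∀ i : {i : ℕ // i ∈ Set.Icc 1 N ∧ p i}, X i ω = X' i ω :=
      ae_all_iff.2 fun i => hX i i.2.1
    filter_upwards [this] with ω hω
    exact funext hω
  intro k
  -- Indices below `k + 1` are those at most `k`, which is the cut in `IsMDependent`; below 0 there
  -- is nothing.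
  rcases k with _ | k
  · have : generatedBy X' (Set.Iio 0) = ⊥ := by simp [generatedBy]
    rw [this]
    exact indep_bot_left _
  · have hi := (IndepFun_iff_Indep _ _ μ).1 ((h k).congr (hae _) (hae _))
    refine indep_of_indep_of_le_right (indep_of_indep_of_le_left hi (hle fun i hi => ?_))
      (hle fun i hi => ?_)
    · exact Nat.lt_succ_iff.1 hi
    · have : k + 1 + m ≤ i := hi
      omega

variable {m : ℕ} {W : ℕ → Ω → ℝ}

omit [IsProbabilityMeasure μ] in
lemma GapIndep.comp (h : GapIndep m W μ) {g : ℕ → ℝ → ℝ} (hg : ∀ i, Measurable (g i)) :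
    GapIndep m (fun i ω => g i (W i ω)) μ := by
  have hle : ∀ s, generatedBy (fun i ω => g i (W i ω)) s ≤ generatedBy W s := fun s =>
    iSup₂_le fun i hi => ((hg i).comp (measurable_generatedBy hi)).comap_le
  exact fun k => indep_of_indep_of_le_right (indep_of_indep_of_le_left (h k) (hle _)) (hle _)

/-- The sum over the `j`-th block of length `m`. -/
def blockSum {Ω : Type*} (m : ℕ) (W : ℕ → Ω → ℝ) (j : ℕ) : Ω → ℝ :=
  segSum W (j * m) ((j + 1) * m)

omit [IsProbabilityMeasure μ] in
lemma GapIndep.gapIndep_blockSum (h : GapIndep m W μ) : GapIndep 1 (blockSum m W) μ := by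
  intro k
  refine indep_of_indep_of_le_right (indep_of_indep_of_le_left (h (k * m)) ?_) ?_
  · refine iSup₂_le fun j hj => Measurable.comap_le (measurable_segSum_generatedBy fun i hi => ?_)
    exact (Finset.mem_Ico.1 hi).2.trans_le (Nat.mul_le_mul_right m hj)
  · refine iSup₂_le fun j hj => Measurable.comap_le (measurable_segSum_generatedBy fun i hi => ?_)
    have h1 := (Finset.mem_Ico.1 hi).1
    have h2 := Nat.mul_le_mul_right m (show k + 1 ≤ j from hj)
    show k * m + m ≤ i
    linarith

omit [MeasurableSpace Ω] in
lemma segSum_blockSum (m : ℕ) (W : ℕ → Ω → ℝ) (n : ℕ) (ω : Ω) :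
    segSum (blockSum m W) 0 n ω = segSum W 0 (n * m) ω := by
  induction n with
  | zero => simp [segSum]
  | succ n ih =>
    rw [segSum_succ (Nat.zero_le n), ih, blockSum,
      segSum_add_segSum (Nat.zero_le _) (Nat.mul_le_mul_right m (Nat.le_succ n))]

/-- The second moment of a sum of centred `m`-dependent variables is at most `3 m` times the sum
of the second moments. -/
lemma GapIndep.integral_sq_segSum_mul_le (h : GapIndep m W μ) (hW : ∀ i, MemLp (W i) 2 μ)
    (h0 : ∀ i, ∫ ω, W i ω ∂μ = 0) (n : ℕ) :
    ∫ ω, segSum W 0 (n * m) ω ^ 2 ∂μ ≤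
      3 * m * ∑ i ∈ Finset.range (n * m), ∫ ω, W i ω ^ 2 ∂μ := by
  -- Cauchy–Schwarz within a block gives the factor `m`; 1-dependence of the blocks gives the 3.
  have hblock : ∀ j, ∫ ω, blockSum m W j ω ^ 2 ∂μ ≤
      m * ∑ i ∈ Finset.Ico (j * m) ((j + 1) * m), ∫ ω, W i ω ^ 2 ∂μ := by
    intro j
    rw [← integral_finsetSum _ fun i _ => (hW i).integrable_sq, ← integral_const_mul]
    refine integral_mono (memLp_segSum hW _ _).integrable_sq
      ((integrable_finsetSum _ fun i _ => (hW i).integrable_sq).const_mul _) fun ω => ?_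
    have := sq_sum_le_card_mul_sum_sq (s := Finset.Ico (j * m) ((j + 1) * m))
      (f := fun i => W i ω)
    rwa [Nat.card_Ico, ← Nat.sub_mul, Nat.add_sub_cancel_left, one_mul] at this
  have h1 := h.gapIndep_blockSum.integral_sq_segSum_le (fun j => memLp_segSum hW _ _)
    (fun j => integral_segSum hW h0 _ _) n
  simp_rw [segSum_blockSum] at h1
  have hsum : ∀ f : ℕ → ℝ, ∑ j ∈ Finset.range n, ∑ i ∈ Finset.Ico (j * m) ((j + 1) * m), f i =
      ∑ i ∈ Finset.range (n * m), f i := by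
    intro f
    have := segSum_blockSum m (fun i (_ : Unit) => f i) n ()
    simpa [segSum, blockSum] using this
  refine h1.trans ?_
  rw [mul_assoc, ← hsum, Finset.mul_sum (Finset.range n) _ (m : ℝ)]
  exact mul_le_mul_of_nonneg_left (Finset.sum_le_sum fun j _ => hblock j) zero_le_three

/-- A row of `m`-dependent variables divided by `σ` is close in mean square to a sum of bounded
`1`-dependent variables. -/
lemma GapIndep.exists_isBoundedOneDependent {N : ℕ} {X : ℕ → Ω → ℝ} {σ ε : ℝ}
    (h : GapIndep m X μ) (hm : 1 ≤ m) (hX : ∀ i, Measurable (X i)) (hL2 : ∀ i, MemLp (X i) 2 μ)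
    (h0 : ∀ i, ∫ ω, X i ω ∂μ = 0) (hN : ∀ i ∉ Set.Icc 1 N, X i = 0) (hσ : 0 < σ) (hε : 0 < ε) :
    ∃ (W : ℕ → Ω → ℝ) (n : ℕ), IsBoundedOneDependent W (2 * ε) μ ∧
      ∫ ω, (rowSum N X ω / σ - segSum W 0 n ω) ^ 2 ∂μ ≤ 3 * (m / σ ^ 2 *
        ∑ i ∈ Finset.Icc 1 N,
          ∫ ω, {ω | ε * σ / m < |X i ω|}.indicator (fun ω => X i ω ^ 2) ω ∂μ) := by
  have hm0 : (0 : ℝ) < m := by exact_mod_cast hm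
  -- At this level a block of `m` truncated, recentred variables is at most `m * (2 * c) / σ = 2 *
  -- ε`.
  set c := ε * σ / m with hc
  have hc0 : 0 < c := by positivity
  set p : ℝ → ℝ := {x | |x| ≤ c}.indicator id with hp
  set q : ℝ → ℝ := {x | c < |x|}.indicator id with hq
  have hpm : Measurable p := measurable_id.indicator (measurableSet_le measurable_abs
    measurable_const)
  have hqm : Measurable q := measurable_id.indicator (measurableSet_lt measurable_const
    measurable_abs)
  have hpq : ∀ x, p x + q x = x := fun x => by
    rcases le_or_gt |x| c with hx | hx
    · simp [hp, hq, hx]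
    · simp [hp, hq, hx, not_le.2 hx]
  have hpc : ∀ x, |p x| ≤ c := fun x => by
    by_cases hx : |x| ≤ c
    · simp [hp, hx]
    · simp [hp, hx, hc0.le]
  have hpX : ∀ i, MemLp (fun ω => p (X i ω)) 2 μ := fun i =>
    MemLp.of_bound (hpm.comp (hX i)).aestronglyMeasurable c (ae_of_all _ fun ω => hpc _)
  have hqX : ∀ i, MemLp (fun ω => q (X i ω)) 2 μ := fun i => by
    refine ((hL2 i).sub (hpX i)).ae_eq (ae_of_all _ fun ω => ?_)
    have := hpq (X i ω)
    simp only [Pi.sub_apply]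
    linarith
  have hpi : ∀ i, Integrable (fun ω => p (X i ω)) μ := fun i => (hpX i).integrable (by norm_num)
  have hqi : ∀ i, Integrable (fun ω => q (X i ω)) μ := fun i => (hqX i).integrable (by norm_num)
  -- The two means cancel, so recentring both parts keeps `X i / σ = U i + D i` exact.
  have hmean : ∀ i, ∫ ω, p (X i ω) ∂μ + ∫ ω, q (X i ω) ∂μ = 0 := fun i => by
    rw [← integral_add (hpi i) (hqi i), ← h0 i]
    simp_rw [hpq]
  set U : ℕ → Ω → ℝ := fun i ω => (p (X i ω) - ∫ ω, p (X i ω) ∂μ) / σ with hU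
  set D : ℕ → Ω → ℝ := fun i ω => (q (X i ω) - ∫ ω, q (X i ω) ∂μ) / σ with hD
  have hUD : ∀ i ω, X i ω / σ - U i ω = D i ω := fun i ω => by
    rw [hU, hD, ← sub_div]
    congr 1
    linarith [hpq (X i ω), hmean i]
  have hUG : GapIndep m U μ :=
    h.comp (g := fun i x => (p x - ∫ ω, p (X i ω) ∂μ) / σ)
      fun i => (hpm.sub_const _).div_const _
  have hDG : GapIndep m D μ :=
    h.comp (g := fun i x => (q x - ∫ ω, q (X i ω) ∂μ) / σ)
      fun i => (hqm.sub_const _).div_const _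
  have hUm : ∀ i, Measurable (U i) := fun i => ((hpm.comp (hX i)).sub_const _).div_const _
  have hU0 : ∀ i, ∫ ω, U i ω ∂μ = 0 := fun i => by
    simp only [hU]
    rw [integral_div, integral_sub (hpi i) (integrable_const _)]
    simp
  have hD0 : ∀ i, ∫ ω, D i ω ∂μ = 0 := fun i => by
    simp only [hD]
    rw [integral_div, integral_sub (hqi i) (integrable_const _)]
    simp
  have hU2 : ∀ i, MemLp (U i) 2 μ := fun i => by
    refine (((hpX i).sub (memLp_const (∫ ω, p (X i ω) ∂μ))).const_mul σ⁻¹).ae_eq (ae_of_all _ fun ω => ?_)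
    simp only [hU, div_eq_inv_mul, Pi.sub_apply]
  have hD2 : ∀ i, MemLp (D i) 2 μ := fun i => by
    refine (((hqX i).sub (memLp_const (∫ ω, q (X i ω) ∂μ))).const_mul σ⁻¹).ae_eq (ae_of_all _ fun ω => ?_)
    simp only [hD, div_eq_inv_mul, Pi.sub_apply]
  have hUb : ∀ i ω, |U i ω| ≤ 2 * ε / m := fun i ω => by
    have h1 : |∫ ω, p (X i ω) ∂μ| ≤ c := by
      simpa using norm_integral_le_of_norm_le_const (μ := μ) (f := fun ω => p (X i ω)) (C := c)
        (ae_of_all _ fun ω => hpc (X i ω))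
    simp only [hU]
    rw [abs_div, abs_of_pos hσ, div_le_iff₀ hσ]
    refine (abs_sub _ _).trans ((add_le_add (hpc _) h1).trans (le_of_eq ?_))
    rw [hc]
    ring
  -- Recentring only lowers the second moment.
  have hDle : ∀ i, ∫ ω, D i ω ^ 2 ∂μ ≤
      (∫ ω, {ω | c < |X i ω|}.indicator (fun ω => X i ω ^ 2) ω ∂μ) / σ ^ 2 := fun i => by
    have e1 : ∀ ω, {ω | c < |X i ω|}.indicator (fun ω => X i ω ^ 2) ω = q (X i ω) ^ 2 :=
      fun ω => by
        by_cases hω : c < |X i ω| <;> simp [hq, hω]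
    simp_rw [e1, hD, div_pow]
    rw [integral_div]
    refine div_le_div_of_nonneg_right ?_ (sq_nonneg σ)
    rw [← variance_eq_integral (hqX i).1.aemeasurable]
    exact variance_le_expectation_sq (hqX i).1
  refine ⟨blockSum m U, N + 1, ⟨fun j => measurable_segSum hUm _ _, fun j ω => ?_,
    fun j => integral_segSum hU2 hU0 _ _, hUG.gapIndep_blockSum⟩, ?_⟩
  · rw [blockSum, segSum]
    refine (Finset.abs_sum_le_sum_abs _ _).trans
      ((Finset.sum_le_card_nsmul _ _ _ fun i _ => hUb i ω).trans (le_of_eq ?_))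
    rw [Nat.card_Ico, ← Nat.sub_mul, Nat.add_sub_cancel_left, one_mul, nsmul_eq_mul]
    field_simp
  · have hsub : Finset.Icc 1 N ⊆ Finset.range ((N + 1) * m) := fun i hi => by
      have h1 := (Finset.mem_Icc.1 hi).2
      have h2 := Nat.le_mul_of_pos_right (N + 1) hm
      exact Finset.mem_range.2 (by omega)
    have hnot : ∀ i, i ∉ Finset.Icc 1 N → X i = 0 := fun i hi =>
      hN i fun hi' => hi (Finset.mem_Icc.2 hi')
    have e1 : ∀ ω, rowSum N X ω / σ - segSum (blockSum m U) 0 (N + 1) ω =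
        segSum D 0 ((N + 1) * m) ω := fun ω => by
      rw [segSum_blockSum, segSum, segSum, ← Finset.range_eq_Ico, rowSum,
        Finset.sum_subset hsub fun i _ hi => by simp [hnot i hi], Finset.sum_div,
        ← Finset.sum_sub_distrib]
      exact Finset.sum_congr rfl fun i _ => hUD i ω
    simp_rw [e1]
    refine (hDG.integral_sq_segSum_mul_le hD2 hD0 (N + 1)).trans ?_
    rw [mul_assoc, Finset.sum_subset hsub fun i _ hi => by simp [hnot i hi]]
    refine mul_le_mul_of_nonneg_left ?_ zero_le_three
    rw [div_mul_eq_mul_div, mul_div_assoc, Finset.sum_div]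
    exact mul_le_mul_of_nonneg_left (Finset.sum_le_sum fun i _ => hDle i) hm0.le

end GapIndep

/-! ### Normalised rows and comparison of characteristic functions. -/

section Row

variable {Ω : Type*} [MeasurableSpace Ω] {μ : Measure Ω} [IsProbabilityMeasure μ]

omit [IsProbabilityMeasure μ] in
-- Weighted AM–GM on the cross term; the free weight `θ` takes the place of a square root of `r`.
lemma abs_integral_sq_sub_one_le {T T' : Ω → ℝ} {r θ : ℝ} (hT : MemLp T 2 μ)
    (hT' : MemLp T' 2 μ) (h1 : ∫ ω, T ω ^ 2 ∂μ = 1) (hr : ∫ ω, (T ω - T' ω) ^ 2 ∂μ ≤ r)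
    (hθ : 0 < θ) : |∫ ω, T' ω ^ 2 ∂μ - 1| ≤ θ + (1 + 1 / θ) * r := by
  have hD : Integrable (fun ω => (T ω - T' ω) ^ 2) μ := (hT.sub hT').integrable_sq
  have hb : Integrable (fun ω => θ * T ω ^ 2 + (1 + 1 / θ) * (T ω - T' ω) ^ 2) μ :=
    (hT.integrable_sq.const_mul _).add (hD.const_mul _)
  rw [← h1, ← integral_sub hT'.integrable_sq hT.integrable_sq, ← Real.norm_eq_abs]
  refine (norm_integral_le_of_norm_le hb (ae_of_all _ fun ω => ?_)).trans ?_
  · have e : (1 + 1 / θ) * (T ω - T' ω) ^ 2 =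
        (T ω - T' ω) ^ 2 + ((T ω - T' ω) ^ 2 / θ) := by ring
    have h2 : 2 * (|T ω| * |T ω - T' ω|) ≤ θ * T ω ^ 2 + (T ω - T' ω) ^ 2 / θ := by
      rw [← sq_abs (T ω), ← sq_abs (T ω - T' ω), ← sub_nonneg]
      have e2 : θ * |T ω| ^ 2 + |T ω - T' ω| ^ 2 / θ - 2 * (|T ω| * |T ω - T' ω|) =
          (θ * |T ω| - |T ω - T' ω|) ^ 2 / θ := by
        field_simp
        ring
      rw [e2]
      positivity
    have h3 : |T' ω ^ 2 - T ω ^ 2| ≤ (T ω - T' ω) ^ 2 + 2 * (|T ω| * |T ω - T' ω|) := by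
      have e3 : T' ω ^ 2 - T ω ^ 2 = (T ω - T' ω) ^ 2 - 2 * (T ω * (T ω - T' ω)) := by ring
      rw [e3]
      refine (abs_sub _ _).trans (le_of_eq ?_)
      rw [abs_mul, abs_mul, abs_two, abs_of_nonneg (sq_nonneg _)]
    rw [Real.norm_eq_abs, e]
    linarith
  · rw [integral_add (hT.integrable_sq.const_mul _) (hD.const_mul _), integral_const_mul,
      integral_const_mul, h1, mul_one]
    gcongr

lemma integral_abs_le_of_integral_sq_le {D : Ω → ℝ} {r θ : ℝ} (hD : MemLp D 2 μ)
    (hr : ∫ ω, D ω ^ 2 ∂μ ≤ r) (hθ : 0 < θ) : ∫ ω, |D ω| ∂μ ≤ (θ + r / θ) / 2 := by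
  have h1 := integral_mono (μ := μ) (hD.integrable (by norm_num)).abs
    (((integrable_const θ).add (hD.integrable_sq.div_const θ)).div_const 2) fun ω => by
      have e : (θ + D ω ^ 2 / θ) / 2 - |D ω| = (θ - |D ω|) ^ 2 / (2 * θ) := by
        rw [← sq_abs (D ω)]
        field_simp
        ring
      have : 0 ≤ (θ - |D ω|) ^ 2 / (2 * θ) := by positivity
      show |D ω| ≤ (θ + D ω ^ 2 / θ) / 2
      linarith
  simp only [Pi.add_apply] at h1
  rw [integral_div, integral_add (integrable_const θ) (hD.integrable_sq.div_const θ),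
    integral_div] at h1
  simp only [integral_const, probReal_univ, one_smul] at h1
  refine h1.trans ?_
  gcongr

variable {m N : ℕ} {X : ℕ → Ω → ℝ}

omit [IsProbabilityMeasure μ] in
lemma memLp_rowSum (hL2 : ∀ i ∈ Finset.Icc 1 N, MemLp (X i) 2 μ) :
    MemLp (rowSum N X) 2 μ :=
  memLp_finsetSum _ hL2

lemma integral_rowSum (hL2 : ∀ i ∈ Finset.Icc 1 N, MemLp (X i) 2 μ)
    (hmean : ∀ i ∈ Finset.Icc 1 N, ∫ ω, X i ω ∂μ = 0) : ∫ ω, rowSum N X ω ∂μ = 0 := by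
  simp only [rowSum]
  rw [integral_finsetSum _ fun i hi => (hL2 i hi).integrable (by norm_num)]
  exact Finset.sum_eq_zero hmean

lemma integral_sq_rowSum_div_rowSD (hL2 : ∀ i ∈ Finset.Icc 1 N, MemLp (X i) 2 μ)
    (hmean : ∀ i ∈ Finset.Icc 1 N, ∫ ω, X i ω ∂μ = 0) (hvar : 0 < Var[rowSum N X; μ]) :
    ∫ ω, (rowSum N X ω / rowSD N X μ) ^ 2 ∂μ = 1 := by
  simp_rw [div_pow]
  rw [integral_div, ← variance_of_integral_eq_zero (memLp_rowSum hL2).1.aemeasurable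
    (integral_rowSum hL2 hmean), rowSD, Real.sq_sqrt hvar.le, div_self hvar.ne']

/-- A normalised row of `m`-dependent variables is close in mean square to a sum of bounded
`1`-dependent variables. -/
lemma IsMDependent.exists_isBoundedOneDependent (hm : 1 ≤ m)
    (hL2 : ∀ i ∈ Finset.Icc 1 N, MemLp (X i) 2 μ) (hdep : IsMDependent m (Set.Icc 1 N) X μ)
    (hmean : ∀ i ∈ Finset.Icc 1 N, ∫ ω, X i ω ∂μ = 0) (hvar : 0 < Var[rowSum N X; μ]) {ε : ℝ}
    (hε : 0 < ε) :
    ∃ (W : ℕ → Ω → ℝ) (n : ℕ), IsBoundedOneDependent W (2 * ε) μ ∧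
      ∫ ω, (rowSum N X ω / rowSD N X μ - segSum W 0 n ω) ^ 2 ∂μ ≤
        3 * ((m : ℝ) / Var[rowSum N X; μ] * ∑ i ∈ Finset.Icc 1 N,
          ∫ ω, {ω | ε * rowSD N X μ / (m : ℝ) < |X i ω|}.indicator
            (fun ω => X i ω ^ 2) ω ∂μ) := by
  classical
  -- Measurable modifications within the row and zero outside give a sequence defined for all
  -- indices.
  set X' : ℕ → Ω → ℝ := fun i =>
    if hi : i ∈ Finset.Icc 1 N then (hL2 i hi).1.mk (X i) else 0 with hX'
  have hae : ∀ i ∈ Finset.Icc 1 N, X i =ᵐ[μ] X' i := fun i hi => by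
    simp only [hX', hi, dif_pos]
    exact (hL2 i hi).1.ae_eq_mk
  have hzero : ∀ i ∉ Finset.Icc 1 N, X' i = 0 := fun i hi => by
    simp only [hX', hi, dif_neg, not_false_eq_true]
  have hprop : ∀ i, Measurable (X' i) ∧ MemLp (X' i) 2 μ ∧ ∫ ω, X' i ω ∂μ = 0 := fun i => by
    by_cases hi : i ∈ Finset.Icc 1 N
    · refine ⟨?_, (hL2 i hi).ae_eq (hae i hi), ?_⟩
      · simp only [hX', hi, dif_pos]
        exact (hL2 i hi).1.stronglyMeasurable_mk.measurable
      · rw [← integral_congr_ae (hae i hi), hmean i hi]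
    · rw [hzero i hi]
      exact ⟨measurable_const, MemLp.zero, by simp⟩
  have hG : GapIndep m X' μ := hdep.gapIndep (fun i hi => hae i (Finset.mem_Icc.2 hi))
    fun i hi => hzero i fun h => hi (Finset.mem_Icc.1 h)
  obtain ⟨W, n, hW, hle⟩ := hG.exists_isBoundedOneDependent hm (fun i => (hprop i).1)
    (fun i => (hprop i).2.1) (fun i => (hprop i).2.2)
    (fun i hi => hzero i fun h => hi (Finset.mem_Icc.1 h)) (Real.sqrt_pos.2 hvar) hε
  refine ⟨W, n, hW, ?_⟩
  have hall : ∀ᵐ ω ∂μ, ∀ i ∈ Finset.Icc 1 N, X i ω = X' i ω :=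
    (Finset.eventually_all _).2 hae
  have hsum : ∫ ω, (rowSum N X ω / rowSD N X μ - segSum W 0 n ω) ^ 2 ∂μ =
      ∫ ω, (rowSum N X' ω / √Var[rowSum N X; μ] - segSum W 0 n ω) ^ 2 ∂μ := by
    refine integral_congr_ae ?_
    filter_upwards [hall] with ω hω
    rw [rowSum, rowSum, Finset.sum_congr rfl hω, rowSD]
  rw [hsum]
  refine hle.trans (le_of_eq ?_)
  rw [Real.sq_sqrt hvar.le]
  congr 2
  refine Finset.sum_congr rfl fun i hi => integral_congr_ae ?_
  filter_upwards [hae i hi] with ω hω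
  simp only [Set.indicator, Set.mem_ofPred_eq, hω, rowSD]

/-- The distance of the characteristic function of a normalised row to the Gaussian one, in terms
of the Lindeberg sum. -/
lemma norm_charFun_rowSum_sub_le (hm : 1 ≤ m)
    (hL2 : ∀ i ∈ Finset.Icc 1 N, MemLp (X i) 2 μ) (hdep : IsMDependent m (Set.Icc 1 N) X μ)
    (hmean : ∀ i ∈ Finset.Icc 1 N, ∫ ω, X i ω ∂μ = 0) (hvar : 0 < Var[rowSum N X; μ])
    {ε θ r t τ : ℝ} (hε : 0 < ε) (hθ : 0 < θ)
    (hr : 3 * ((m : ℝ) / Var[rowSum N X; μ] * ∑ i ∈ Finset.Icc 1 N,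
          ∫ ω, {ω | ε * rowSD N X μ / (m : ℝ) < |X i ω|}.indicator
            (fun ω => X i ω ^ 2) ω ∂μ) ≤ r)
    (hsmall : θ + (1 + 1 / θ) * r ≤ 1)
    (hτ : ∀ (W : ℕ → Ω → ℝ) (n : ℕ), IsBoundedOneDependent W (2 * ε) μ → segVar W μ 0 n ≤ 2 →
      ‖charFun (μ.map (segSum W 0 n)) t - gaussianChar t (segVar W μ 0 n)‖ ≤ τ) :
    ‖charFun (μ.map fun ω => rowSum N X ω / rowSD N X μ) t - gaussianChar t 1‖ ≤
      |t| * ((θ + r / θ) / 2) + τ + t ^ 2 / 2 * (θ + (1 + 1 / θ) * r) := by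
  obtain ⟨W, n, hW, hle⟩ := hdep.exists_isBoundedOneDependent hm hL2 hmean hvar hε
  have hle := hle.trans hr
  have hT : MemLp (fun ω => rowSum N X ω / rowSD N X μ) 2 μ := by
    simpa only [div_eq_inv_mul] using (memLp_rowSum hL2).const_mul (rowSD N X μ)⁻¹
  have hT' := memLp_segSum hW.memLp 0 n
  have hv := abs_integral_sq_sub_one_le hT hT' (integral_sq_rowSum_div_rowSD hL2 hmean hvar) hle hθ
  have hd := integral_abs_le_of_integral_sq_le (hT.sub hT') hle hθ
  have h1 := (norm_charFun_map_sub_le hT.1.aemeasurable hT'.1.aemeasurable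
    ((hT.sub hT').integrable (by norm_num)).abs t).trans
      (mul_le_mul_of_nonneg_left hd (abs_nonneg t))
  have h2 := hτ W n hW (by
    have := (abs_le.1 (hv.trans hsmall)).2
    simp only [segVar]
    linarith)
  have h3 := (norm_gaussianChar_sub_le t (segVar_nonneg W μ 0 n) zero_le_one).trans
    (mul_le_mul_of_nonneg_left hv (by positivity))
  have h4 := norm_sub_le_norm_sub_add_norm_sub
    (charFun (μ.map fun ω => rowSum N X ω / rowSD N X μ) t) (charFun (μ.map (segSum W 0 n)) t)
    (gaussianChar t 1)
  have h5 := norm_sub_le_norm_sub_add_norm_sub (charFun (μ.map (segSum W 0 n)) t)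
    (gaussianChar t (segVar W μ 0 n)) (gaussianChar t 1)
  linarith

end Row

/-! ### The central limit theorem. -/

theorem theorem2 {Ω : ℕ → Type*} [∀ n, MeasurableSpace (Ω n)]
    (μ : (n : ℕ) → Measure (Ω n)) [∀ n, IsProbabilityMeasure (μ n)]
    (m N : ℕ → ℕ) (hm : ∀ n, 1 ≤ m n)
    (X : (n : ℕ) → ℕ → Ω n → ℝ)
    (hL2 : ∀ n, ∀ i ∈ Finset.Icc 1 (N n), MemLp (X n i) 2 (μ n))
    (hdep : ∀ n, IsMDependent (m n) (Set.Icc 1 (N n)) (X n) (μ n))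
    (hmean : ∀ n, ∀ i ∈ Finset.Icc 1 (N n), ∫ ω, X n i ω ∂(μ n) = 0)
    (hvar : ∀ᶠ n in atTop, 0 < Var[rowSum (N n) (X n); μ n])
    (hLindeberg : ∀ ε : ℝ, 0 < ε → Tendsto
      (fun n => (m n : ℝ) / Var[rowSum (N n) (X n); μ n] *
        ∑ i ∈ Finset.Icc 1 (N n),
          ∫ ω, {ω | ε * rowSD (N n) (X n) (μ n) / (m n : ℝ) < |X n i ω|}.indicator
            (fun ω => X n i ω ^ 2) ω ∂(μ n))
      atTop (𝓝 0)) :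
    TendstoInDistribution
      (fun n ω => rowSum (N n) (X n) ω / rowSD (N n) (X n) (μ n)) atTop
      (id : ℝ → ℝ) μ (gaussianReal 0 1) := by
  have hae : ∀ n, AEMeasurable (fun ω => rowSum (N n) (X n) ω / rowSD (N n) (X n) (μ n)) (μ n) :=
    fun n => (memLp_rowSum (hL2 n)).1.aemeasurable.div_const _
  refine ⟨hae, aemeasurable_id, ?_⟩
  refine ProbabilityMeasure.tendsto_iff_tendsto_charFun.2 fun t => ?_
  have hlim : charFun ((gaussianReal 0 1).map id) t = gaussianChar t 1 := by
    rw [Measure.map_id, charFun_gaussianReal, gaussianChar, Complex.ofReal_exp]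
    congr 1
    push_cast
    ring
  simp only [ProbabilityMeasure.coe_mk]
  rw [hlim, Metric.tendsto_nhds]
  intro η hη
  obtain ⟨ε₀, hε₀, hε₀τ⟩ := exists_forall_norm_charFun_segSum_sub_le t (half_pos hη)
  set ε := ε₀ / 2 with hε
  have h2ε : 2 * ε = ε₀ := by ring
  -- With `θ` fixed before `n`, the final bound at `r = 0` is at most `η / 2 + η / 8`; by continuity
  -- it stays below `η` once the Lindeberg term is small.
  set θ := min (1 / 2) (η / (4 * (|t| + t ^ 2 + 1))) with hθdef
  have hθ : 0 < θ := by positivity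
  have hθη : (|t| + t ^ 2) * θ ≤ η / 4 := by
    have h1 : (|t| + t ^ 2) * θ ≤ (|t| + t ^ 2 + 1) * (η / (4 * (|t| + t ^ 2 + 1))) :=
      mul_le_mul (by linarith) (min_le_right _ _) hθ.le (by positivity)
    refine h1.trans (le_of_eq ?_)
    field_simp
  have hL := (hLindeberg ε (by positivity)).const_mul 3
  rw [mul_zero] at hL
  have hvanish : ∀ᶠ r : ℝ in 𝓝 0, θ + (1 + 1 / θ) * r < 1 ∧
      |t| * ((θ + r / θ) / 2) + η / 2 + t ^ 2 / 2 * (θ + (1 + 1 / θ) * r) < η := by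
    have c1 : Continuous fun r : ℝ => θ + (1 + 1 / θ) * r := by fun_prop
    have c2 : Continuous fun r : ℝ =>
      |t| * ((θ + r / θ) / 2) + η / 2 + t ^ 2 / 2 * (θ + (1 + 1 / θ) * r) := by fun_prop
    refine (c1.continuousAt.eventually_lt continuousAt_const ?_).and
      (c2.continuousAt.eventually_lt continuousAt_const ?_)
    · have : θ ≤ 1 / 2 := min_le_left _ _
      simp only [mul_zero, add_zero]
      linarith
    · simp only [mul_zero, add_zero, zero_div]
      linarith
  filter_upwards [hL.eventually hvanish, hvar] with n hn hvn
  rw [dist_eq_norm]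
  refine (norm_charFun_rowSum_sub_le (hm n) (hL2 n) (hdep n) (hmean n) hvn (by positivity) hθ
    le_rfl hn.1.le ?_).trans_lt hn.2
  intro W k hW hv
  rw [h2ε] at hW
  exact hε₀τ k hW hv
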